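/- A JB$^*$-triple is a complex Banach space $E$ with a continuous triple product $\{\cdot,\cdot,\cdot\}:E\times E\times E\to E$ which is symmetric and linear in the first and third variables and conjugate linear in the second, such that the operators $L(a,b)x=\{a,b,x\}$ satisfy: (a) $L(a,b)L(x,y)=L(x,y)L(a,b)+L(L(a,b)x,y)-L(x,L(b,a)y)$; (b) $L(a,a)$ is a hermitian operator (i.e. $\exp(itL(a,a))$ is isometric for every $t\in\mathbb{R}$) with non-negative spectrum; (c) $\|L(a,a)\|=\|a\|^2$. An element $e\in E$ is a tripotent if $\{e,e,e\}=e$. For a tripotent $e$, let $E_i(e)$ $(i=0,1,2)$ be the eigenspace of $L(e,e)$ for the eigenvalue $i/2$; then $E=E_2(e)\oplus E_1(e)\oplus E_0(e)$, and $P_2(e)=L(e,e)(2L(e,e)-I)$ is the corresponding projection onto $E_2(e)$. A tripotent $e$ is minimal if $e\neq 0$ and $E_2(e)=\mathbb{C}e$. Write $S(E)=\{x\in E:\|x\|=1\}$. Proposition. Let $e$ be a minimal tripotent in a JB$^*$-triple $E$. Then for each $\varepsilon>0$ there exists $\delta>0$ such that for every $x\in S(E)$ with $\|e-x\|>2-\delta$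 we have $\|P_2(e)(e-x)\|>2-\varepsilon$. -/

import Mathlib

/-- A bounded operator `T` on a complex Banach space is *hermitian* if `exp (i t T)` is an isometry
of the space for every real `t` (equivalently, its numerical range is real). -/
def IsHermitianOperator {E : Type*} [NormedAddCommGroup E] [NormedSpace ℂ E] (T : E →L[ℂ] E) :
    Prop :=
  ∀ t : ℝ, ∀ x : E, ‖NormedSpace.exp ((Complex.I * (t : ℂ)) • T) x‖ = ‖x‖

/-- The structure of a *JB\*-triple* on a complex Banach space `E`. The triple product
`{a, b, c} = triple a b c` is continuous, linear in the first and third variables and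
conjugate-linear in the second one; `triple a b` is the operator `L(a, b) : c ↦ {a, b, c}`. -/
class JBStarTriple (E : Type*) [NormedAddCommGroup E] [NormedSpace ℂ E] [CompleteSpace E] where
  /-- The triple product, as the bounded operator-valued map `(a, b) ↦ L(a, b)`. -/
  triple : E →L[ℂ] E →L⋆[ℂ] E →L[ℂ] E
  /-- `{a, b, c} = {c, b, a}`. -/
  symm : ∀ a b c : E, triple a b c = triple c b a
  /-- The Jordan identity
  `L(a,b) L(x,y) = L(x,y) L(a,b) + L(L(a,b)x, y) - L(x, L(b,a)y)`. -/
  jordan : ∀ a b x y : E,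
    triple a b ∘L triple x y =
      triple x y ∘L triple a b + triple (triple a b x) y - triple x (triple b a y)
  /-- `L(a,a)` is hermitian. -/
  hermitian : ∀ a : E, IsHermitianOperator (triple a a)
  /-- `L(a,a)` has non-negative spectrum. -/
  spectrum_nonneg : ∀ a : E, ∀ z ∈ spectrum ℂ (triple a a), z.im = 0 ∧ 0 ≤ z.re
  /-- `‖L(a,a)‖ = ‖a‖²`. -/
  norm_triple_self : ∀ a : E, ‖triple a a‖ = ‖a‖ ^ 2

namespace JBStarTriple

variable {E : Type*} [NormedAddCommGroup E] [NormedSpace ℂ E] [CompleteSpace E] [JBStarTriple E]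

/-- The operator `L(a, b) : c ↦ {a, b, c}`. -/
noncomputable def L (a b : E) : E →L[ℂ] E := triple a b

/-- `e` is a *tripotent* if `{e, e, e} = e`. -/
def IsTripotent (e : E) : Prop := L e e e = e

/-- The *Peirce space* `E_i(e)`, `i = 0, 1, 2`: the eigenspace of `L(e, e)` for `i / 2`. -/
noncomputable def peirceSpace (i : Fin 3) (e : E) : Submodule ℂ E :=
  Module.End.eigenspace (L e e : E →ₗ[ℂ] E) (((i : ℕ) : ℂ) / 2)

/-- The *Peirce-2 projection* `P_2(e) = L(e, e) (2 L(e, e) - I)`: for a tripotent `e`, it is the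
projection onto `E_2(e)` along `E_1(e) ⊕ E_0(e)`. -/
noncomputable def peirceP2 (e : E) : E →L[ℂ] E :=
  L e e ∘L ((2 : ℂ) • L e e - ContinuousLinearMap.id ℂ E)

/-- A *minimal* tripotent: a non-zero tripotent `e` with `E_2(e) = ℂ e`. -/
def IsMinimalTripotent (e : E) : Prop :=
  e ≠ 0 ∧ IsTripotent e ∧ peirceSpace 2 e = Submodule.span ℂ {e}

end JBStarTriple

/-!
The norm of a JB*-triple is uniformly smooth at a minimal tripotent `e`: writing `P_2(e) y = c e`,
one has `‖e + t y‖ ≤ 1 + t Re c + O(t²)` for `‖y‖ ≤ 1` and small `t > 0`, with an absolute constant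
(`IsTripotent.norm_add_smul_le`). For `y = -x` with `‖x‖ = 1` and `P_2(e) x = c e`, the triangle
inequality gives `‖e - t x‖ ≥ ‖e - x‖ - (1 - t) > 1 + t - δ`, so that `Re c ≤ -1 + δ / t + O(t)`,
and `‖P_2(e) (e - x)‖ = |1 - c| ≥ 1 - Re c` is close to `2`.

The smoothness estimate rests on the Peirce decomposition `y = c e + y₁ + y₀`.
The Peirce-0 part `y₀` is orthogonal to `e`, that is `L(e, y₀) = L(y₀, e) = 0`, whence the identity
`‖L(z, z)‖ = ‖z‖²` yields `‖a e + t y₀‖² ≤ |a|² + t² ‖y₀‖²`, which differs from `|a|²` only to second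
order (`IsTripotent.norm_smul_add_sq_le`). The Peirce-1 part is produced by isometries: by
polarization `2 i (L(y₁, e) - L(e, y₁))` is the difference of the hermitian operators `L(a, a)` and
`L(b, b)` for `a = e + i y₁`, `b = e - i y₁`, and it maps `e` to `i y₁`. Hence `e + t y` agrees up to
`O(t²)` with the image of `(1 + t c) e + t y₀` under `(1 - i t L(a, a)) (1 + i t L(b, b))`, a product
of two operators which are isometric up to `O(t²)`.

The norm of a non-zero tripotent is one because `L(e, e)` is a combination of `1` and
`exp (± i π L(e, e))` with coefficients of total modulus one (`IsTripotent.L_eq_exp`).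
-/

/-! ### Hermitian operators and exponentials -/

/-- Second-order Taylor estimate for the exponential in a Banach algebra. -/
theorem norm_exp_sub_one_sub_le_sq {A : Type*} [NormedRing A] [NormedAlgebra ℂ A]
    [CompleteSpace A] (T : A) (hT : ‖T‖ ≤ 1) :
    ‖NormedSpace.exp T - 1 - T‖ ≤ ‖T‖ ^ 2 := by
  have h1 := NormedSpace.exp_series_hasSum_exp' (𝕂 := ℂ) T
  have h2 := (hasSum_nat_add_iff' 2).2 h1
  have h3 := NormedSpace.exp_series_hasSum_exp' (𝕂 := ℝ) (‖T‖)
  have h4 := (hasSum_nat_add_iff' 2).2 h3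
  have h5 := h2.norm_le_of_bounded h4 (fun n => by
    have h := norm_pow_le' T (Nat.succ_pos (n + 1))
    rw [norm_smul, norm_inv, Complex.norm_natCast, smul_eq_mul]
    exact mul_le_mul_of_nonneg_left h (by positivity))
  have h6 : Real.exp ‖T‖ - 1 - ‖T‖ ≤ ‖T‖ ^ 2 := by
    have := Real.norm_exp_sub_one_sub_id_le (x := ‖T‖) (by simpa using hT)
    rw [Real.norm_eq_abs, norm_norm] at this
    exact (le_abs_self _).trans this
  rw [← Real.exp_eq_exp_ℝ] at h5
  simp only [Finset.sum_range_succ, Finset.sum_range_zero, Nat.factorial, Nat.cast_one, inv_one,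
    pow_zero, one_smul, zero_add, pow_one, mul_one, one_mul, smul_eq_mul] at h5
  rw [← sub_sub, ← sub_sub] at h5
  exact h5.trans h6

section Operators

variable {E : Type*} [NormedAddCommGroup E] [NormedSpace ℂ E] [CompleteSpace E]

/-- A hermitian operator `H` has `‖(1 + i t H) x‖ ≤ (1 + O(t²)) ‖x‖`, because `1 + i t H` agrees
to first order with the isometry `exp (i t H)`. -/
theorem IsHermitianOperator.norm_add_smul_apply_le {H : E →L[ℂ] E} (hH : IsHermitianOperator H)
    (t : ℝ) (ht : |t| * ‖H‖ ≤ 1) (x : E) :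
    ‖x + (Complex.I * (t : ℂ)) • H x‖ ≤ (1 + (|t| * ‖H‖) ^ 2) * ‖x‖ := by
  set T : E →L[ℂ] E := (Complex.I * (t : ℂ)) • H with hTdef
  have hT : ‖T‖ = |t| * ‖H‖ := by simp [hTdef, norm_smul]
  have h1 := norm_exp_sub_one_sub_le_sq T (hT ▸ ht)
  have h2 : x + (Complex.I * (t : ℂ)) • H x =
      NormedSpace.exp T x - (NormedSpace.exp T - 1 - T) x := by
    simp only [sub_apply, one_apply_eq_self, hTdef,
      smul_apply]
    abel
  rw [h2]
  calc _ ≤ ‖NormedSpace.exp T x‖ + ‖(NormedSpace.exp T - 1 - T) x‖ := norm_sub_le _ _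
    _ ≤ ‖x‖ + (|t| * ‖H‖) ^ 2 * ‖x‖ := by
      refine add_le_add (hH t x).le ((ContinuousLinearMap.le_opNorm _ _).trans ?_)
      rw [← hT]
      gcongr
    _ = _ := by ring

theorem exp_apply_of_apply_eq_smul (T : E →L[ℂ] E) {c : ℂ} {v : E} (hv : T v = c • v) :
    NormedSpace.exp T v = Complex.exp c • v := by
  have hpow : ∀ n : ℕ, (T ^ n) v = c ^ n • v := by
    intro n
    induction n with
    | zero => simp
    | succ n ih => rw [pow_succ', mul_apply_eq_comp, ih, map_smul, hv, smul_smul,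
        pow_succ]
  have h1 := (NormedSpace.exp_series_hasSum_exp' (𝕂 := ℂ) T).mapL (ContinuousLinearMap.apply ℂ E v)
  have h2 := (NormedSpace.exp_series_hasSum_exp' (𝕂 := ℂ) c).mapL
    ((ContinuousLinearMap.id ℂ ℂ).smulRight v)
  rw [← Complex.exp_eq_exp_ℂ] at h2
  refine h1.unique ?_
  simpa [hpow, smul_smul, ContinuousLinearMap.smulRight_apply] using h2

end Operators

/-! ### Peirce decomposition of a tripotent -/

namespace JBStarTriple

variable {E : Type*} [NormedAddCommGroup E] [NormedSpace ℂ E] [CompleteSpace E] [JBStarTriple E]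

theorem L_symm (a b c : E) : L a b c = L c b a := symm a b c

theorem L_add_left (a b c : E) : L (a + b) c = L a c + L b c := by simp [L]

theorem L_add_right (a b c : E) : L a (b + c) = L a b + L a c := by simp [L]

theorem L_smul_left (r : ℂ) (a b : E) : L (r • a) b = r • L a b := by simp [L]

theorem L_smul_right (r : ℂ) (a b : E) : L a (r • b) = (starRingEnd ℂ) r • L a b := by simp [L]

theorem L_zero_left (b : E) : L 0 b = 0 := by simp [L]

theorem L_zero_right (a : E) : L a 0 = 0 := by simp [L]

/-- The Jordan identity, evaluated at a vector. -/
theorem L_apply_L_apply (a b x y z : E) :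
    L a b (L x y z) = L x y (L a b z) + L (L a b x) y z - L x (L b a y) z := by
  have h := DFunLike.congr_fun (jordan a b x y) z
  simpa [L] using h

/-- The quadratic operator `x ↦ {e, x, e}` is unchanged by composition with
`L(e, e)` on either side: two instances of the Jordan identity determine both compositions. -/
theorem IsTripotent.L_L_L {e : E} (he : IsTripotent e) (x : E) :
    L e e (L e x e) = L e x e ∧ L e (L e e x) e = L e x e := by
  have he' : L e e e = e := he
  have h1 := L_apply_L_apply e e e x e
  have h2 := L_apply_L_apply e x e e e
  rw [he'] at h1 h2
  rw [L_symm (L e x e) e e, L_symm x e e] at h2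
  set a := L e e (L e x e)
  set b := L e (L e e x) e
  set q := L e x e
  have h3 : (3 : ℂ) • a = (3 : ℂ) • q := by
    linear_combination (norm := module) h1 - h2
  have h4 : a = q := smul_right_injective E (by norm_num : (3 : ℂ) ≠ 0) h3
  refine ⟨h4, ?_⟩
  rw [h4] at h1
  linear_combination (norm := module) h1

/-- The Peirce polynomial `L (2 L - 1) (L - 1) = 0` of `L = L(e, e)`. -/
theorem IsTripotent.L_cubic {e : E} (he : IsTripotent e) (x : E) :
    (2 : ℂ) • L e e (L e e (L e e x)) = (3 : ℂ) • L e e (L e e x) - L e e x := by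
  have he' : L e e e = e := he
  have h1 := L_apply_L_apply x e e e e
  rw [he', L_symm x e e, L_symm (L e e x) e e] at h1
  have h2 := (he.L_L_L (L e x e)).1
  have h3 : L e (L e x e) e = (2 : ℂ) • L e e (L e e x) - L e e x := by
    linear_combination (norm := module) h1
  rw [h3] at h2
  simp only [map_sub, map_smul] at h2
  linear_combination (norm := module) h2

/-- The Peirce-1 projection `4 (L - L²)` of a tripotent, `L = L(e, e)`. -/
noncomputable def peirceP1 (e : E) : E →L[ℂ] E :=
  (4 : ℂ) • (L e e - L e e ∘L L e e)

/-- The Peirce-0 projection `1 - 3 L + 2 L²` of a tripotent, `L = L(e, e)`. -/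
noncomputable def peirceP0 (e : E) : E →L[ℂ] E :=
  ContinuousLinearMap.id ℂ E - (3 : ℂ) • L e e + (2 : ℂ) • (L e e ∘L L e e)

theorem peirceP2_apply (e x : E) : peirceP2 e x = (2 : ℂ) • L e e (L e e x) - L e e x := by
  simp [peirceP2]

theorem peirceP1_apply (e x : E) : peirceP1 e x = (4 : ℂ) • (L e e x - L e e (L e e x)) := by
  simp [peirceP1]

theorem peirceP0_apply (e x : E) :
    peirceP0 e x = x - (3 : ℂ) • L e e x + (2 : ℂ) • L e e (L e e x) := by
  simp [peirceP0]

theorem peirce_decomposition (e x : E) : peirceP2 e x + peirceP1 e x + peirceP0 e x = x := by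
  rw [peirceP2_apply, peirceP1_apply, peirceP0_apply]
  module

theorem IsTripotent.L_peirceP2 {e : E} (he : IsTripotent e) (x : E) :
    L e e (peirceP2 e x) = peirceP2 e x := by
  rw [peirceP2_apply, map_sub, map_smul]
  linear_combination (norm := module) he.L_cubic x

theorem IsTripotent.L_peirceP1 {e : E} (he : IsTripotent e) (x : E) :
    L e e (peirceP1 e x) = (1 / 2 : ℂ) • peirceP1 e x := by
  rw [peirceP1_apply, map_smul, map_sub]
  linear_combination (norm := module) (-2 : ℂ) • he.L_cubic x

theorem IsTripotent.L_peirceP0 {e : E} (he : IsTripotent e) (x : E) :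
    L e e (peirceP0 e x) = 0 := by
  rw [peirceP0_apply, map_add, map_sub, map_smul, map_smul]
  linear_combination (norm := module) he.L_cubic x

/-- The operators `exp (± i π L(e, e))` act on `E_k(e)` as `(± i) ^ k`, so that
`L(e, e) = 1/2 - (exp (i π L(e, e)) + exp (- i π L(e, e))) / 4`. -/
theorem IsTripotent.L_eq_exp {e : E} (he : IsTripotent e) (x : E) :
    L e e x = (1 / 2 : ℂ) • x -
      (1 / 4 : ℂ) • (NormedSpace.exp ((Complex.I * (Real.pi : ℝ)) • L e e) x +
        NormedSpace.exp ((Complex.I * ((-Real.pi : ℝ) : ℂ)) • L e e) x) := by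
  have key : ∀ (r : ℝ) (l : ℂ) (v : E), L e e v = l • v →
      NormedSpace.exp ((Complex.I * (r : ℂ)) • L e e) v = Complex.exp (Complex.I * r * l) • v := by
    intro r l v hv
    refine exp_apply_of_apply_eq_smul _ ?_
    rw [smul_apply, hv, smul_smul]
  have e1 : Complex.exp (Complex.I * (Real.pi : ℝ) * 1) = -1 := by
    rw [mul_one, mul_comm, Complex.exp_pi_mul_I]
  have e2 : Complex.exp (Complex.I * ((-Real.pi : ℝ) : ℂ) * 1) = -1 := by
    rw [mul_one, mul_comm]
    push_cast
    rw [neg_mul, Complex.exp_neg, Complex.exp_pi_mul_I]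
    norm_num
  have e3 : Complex.exp (Complex.I * (Real.pi : ℝ) * (1 / 2)) = Complex.I := by
    rw [show Complex.I * (Real.pi : ℂ) * (1 / 2) = Real.pi / 2 * Complex.I by ring,
      Complex.exp_pi_div_two_mul_I]
  have e4 : Complex.exp (Complex.I * ((-Real.pi : ℝ) : ℂ) * (1 / 2)) = -Complex.I := by
    push_cast
    rw [show Complex.I * (-(Real.pi : ℂ)) * (1 / 2) = -(Real.pi / 2 * Complex.I) by ring,
      Complex.exp_neg, Complex.exp_pi_div_two_mul_I, Complex.inv_I]
  have h2 : L e e (peirceP2 e x) = (1 : ℂ) • peirceP2 e x := by rw [he.L_peirceP2, one_smul]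
  have h1 := he.L_peirceP1 x
  have h0 : L e e (peirceP0 e x) = (0 : ℂ) • peirceP0 e x := by rw [he.L_peirceP0, zero_smul]
  rw [← peirce_decomposition e x]
  simp only [map_add, key _ _ _ h2, key _ _ _ h1, key _ _ _ h0, e1, e2, e3, e4, mul_zero,
    Complex.exp_zero]
  rw [h2, h1, h0]
  module

theorem IsTripotent.norm_L_le {e : E} (he : IsTripotent e) : ‖L e e‖ ≤ 1 := by
  refine ContinuousLinearMap.opNorm_le_bound _ zero_le_one fun x => ?_
  rw [he.L_eq_exp x]
  refine (norm_sub_le _ _).trans ?_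
  rw [norm_smul, norm_smul]
  have h := norm_add_le (NormedSpace.exp ((Complex.I * (Real.pi : ℝ)) • L e e) x)
    (NormedSpace.exp ((Complex.I * ((-Real.pi : ℝ) : ℂ)) • L e e) x)
  have h1 : ‖NormedSpace.exp ((Complex.I * (Real.pi : ℝ)) • L e e) x‖ = ‖x‖ :=
    hermitian e Real.pi x
  have h2 : ‖NormedSpace.exp ((Complex.I * ((-Real.pi : ℝ) : ℂ)) • L e e) x‖ = ‖x‖ :=
    hermitian e (-Real.pi) x
  rw [h1, h2] at h
  have n2 : ‖(1 / 2 : ℂ)‖ = 1 / 2 := by norm_num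
  have n4 : ‖(1 / 4 : ℂ)‖ = 1 / 4 := by norm_num
  rw [n2, n4]
  linarith

theorem norm_L_self (a : E) : ‖L a a‖ = ‖a‖ ^ 2 := norm_triple_self a

theorem IsTripotent.norm_eq_one {e : E} (he : IsTripotent e) (h0 : e ≠ 0) : ‖e‖ = 1 := by
  have h1 : ‖e‖ ^ 2 ≤ 1 := norm_L_self e ▸ he.norm_L_le
  have h2 : ‖e‖ ≤ ‖e‖ ^ 2 * ‖e‖ := by
    conv_lhs => rw [← (show L e e e = e from he)]
    rw [← norm_L_self]
    exact (L e e).le_opNorm e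
  have h3 : 0 < ‖e‖ := norm_pos_iff.2 h0
  nlinarith

/-- Peirce-0 elements are orthogonal to the tripotent: `L(e, y) = L(y, e) = 0`. -/
theorem IsTripotent.L_eq_zero {e y : E} (he : IsTripotent e) (hy : L e e y = 0) :
    L e y = 0 ∧ L y e = 0 := by
  have he' : L e e e = e := he
  have hq : L e y e = 0 := by
    rw [← (he.L_L_L y).2, hy, L_zero_right, zero_apply]
  have hy' : L y e e = 0 := by rw [L_symm, hy]
  constructor <;> ext x
  · have h1 := L_apply_L_apply e e e y x
    have h2 := L_apply_L_apply e y e e x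
    rw [he', hy, L_zero_right] at h1
    rw [hq, hy', L_zero_right, L_zero_left] at h2
    simp only [zero_apply] at h1 h2 ⊢
    linear_combination (norm := module) -h1 - h2
  · have h1 := L_apply_L_apply e e y e x
    have h2 := L_apply_L_apply y e e e x
    rw [he', hy, L_zero_left] at h1
    rw [hq, hy', L_zero_right, L_zero_left] at h2
    simp only [zero_apply] at h1 h2 ⊢
    linear_combination (norm := module) h1 + h2

/-- The quadratic operator `x ↦ {e, x, e}` vanishes on `E_1(e)`. -/
theorem IsTripotent.L_peirceP1_self {e : E} (he : IsTripotent e) (x : E) :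
    L e (peirceP1 e x) e = 0 := by
  have h := (he.L_L_L (peirceP1 e x)).2
  rw [he.L_peirceP1, L_smul_right] at h
  have hc : (starRingEnd ℂ) (1 / 2 : ℂ) = 1 / 2 := by
    rw [map_div₀, map_one, map_ofNat]
  rw [hc, smul_apply] at h
  linear_combination (norm := module) (-2 : ℂ) • h

/-! ### Smoothness of the norm at a tripotent -/

theorem IsTripotent.norm_L_apply_le {e : E} (he : IsTripotent e) (x : E) : ‖L e e x‖ ≤ ‖x‖ := by
  simpa using (L e e).le_of_opNorm_le he.norm_L_le x

theorem IsTripotent.norm_peirceP2_apply_le {e : E} (he : IsTripotent e) (x : E) :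
    ‖peirceP2 e x‖ ≤ 3 * ‖x‖ := by
  have h1 := he.norm_L_apply_le x
  have h2 := he.norm_L_apply_le (L e e x)
  rw [peirceP2_apply]
  refine (norm_sub_le _ _).trans ?_
  rw [norm_smul, Complex.norm_ofNat]
  linarith

theorem IsTripotent.norm_peirceP1_apply_le {e : E} (he : IsTripotent e) (x : E) :
    ‖peirceP1 e x‖ ≤ 8 * ‖x‖ := by
  have h1 := he.norm_L_apply_le x
  have h2 := he.norm_L_apply_le (L e e x)
  rw [peirceP1_apply, norm_smul, Complex.norm_ofNat]
  have := norm_sub_le (L e e x) (L e e (L e e x))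
  linarith

theorem IsTripotent.norm_peirceP0_apply_le {e : E} (he : IsTripotent e) (x : E) :
    ‖peirceP0 e x‖ ≤ 6 * ‖x‖ := by
  have h1 := he.norm_L_apply_le x
  have h2 := he.norm_L_apply_le (L e e x)
  rw [peirceP0_apply]
  refine (norm_add_le _ _).trans ((add_le_add_left (norm_sub_le _ _) _).trans ?_)
  rw [norm_smul, norm_smul, Complex.norm_ofNat, Complex.norm_ofNat]
  linarith

/-- If `y` is orthogonal to `e`, then `L(a e + y, a e + y) = |a|² L(e, e) + L(y, y)`, and the
identity `‖L(z, z)‖ = ‖z‖²` bounds the norm of `a e + y`. -/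
theorem IsTripotent.norm_smul_add_sq_le {e y : E} (he : IsTripotent e) (hy : L e e y = 0) (a : ℂ) :
    ‖a • e + y‖ ^ 2 ≤ ‖a‖ ^ 2 + ‖y‖ ^ 2 := by
  obtain ⟨h1, h2⟩ := he.L_eq_zero hy
  have h : L (a • e + y) (a • e + y) = (a * (starRingEnd ℂ) a) • L e e + L y y := by
    rw [L_add_left, L_add_right, L_add_right, L_smul_left, L_smul_left, L_smul_right, L_smul_right,
      h1, h2, smul_smul]
    simp
  rw [← norm_L_self, h, ← norm_L_self y]
  refine (norm_add_le _ _).trans (add_le_add_left ?_ _)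
  rw [norm_smul, norm_mul, RCLike.norm_conj, ← sq]
  exact mul_le_of_le_one_right (sq_nonneg _) he.norm_L_le

/-- Polarization: `L(a + i b, a + i b) - L(a - i b, a - i b) = 2 i (L(b, a) - L(a, b))`. -/
theorem L_add_I_smul_sub (a b : E) :
    L (a + Complex.I • b) (a + Complex.I • b) - L (a - Complex.I • b) (a - Complex.I • b) =
      (2 * Complex.I) • (L b a - L a b) := by
  rw [sub_eq_add_neg a, ← neg_smul]
  simp only [L_add_left, L_add_right, L_smul_left, L_smul_right, map_neg, Complex.conj_I]
  module

theorem norm_add_I_mul_smul_L_apply_le (a : E) (r t : ℝ) (ha : ‖a‖ ≤ r) (ht : |t| * r ^ 2 ≤ 1)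
    (x : E) :
    ‖x + (Complex.I * (t : ℂ)) • L a a x‖ ≤ (1 + (|t| * r ^ 2) ^ 2) * ‖x‖ := by
  have h1 : ‖L a a‖ ≤ r ^ 2 := by
    rw [norm_L_self]
    gcongr
  have h2 : |t| * ‖L a a‖ ≤ |t| * r ^ 2 := by gcongr
  refine ((hermitian a).norm_add_smul_apply_le t (h2.trans ht) x).trans ?_
  gcongr
  exact h1

/-- The norm is uniformly smooth at `e` as soon as the direction `y` has `P_2(e) y = c e`: up to
second order, `‖e + t y‖` is at most `1 + t Re c`. The Peirce-1 part of `y` is the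
velocity at `e` of a curve of isometries, and the Peirce-0 part is orthogonal to `e`. -/
theorem IsTripotent.norm_add_smul_le {e y : E} (he : IsTripotent e) (h0 : e ≠ 0) (hy : ‖y‖ ≤ 1)
    {c : ℂ} (hc : peirceP2 e y = c • e) {t : ℝ} (ht0 : 0 < t) (ht : t ≤ 1 / 81) :
    ‖e + (t : ℂ) • y‖ ≤ 1 + t * c.re + 300000 * t ^ 2 := by
  have hen := he.norm_eq_one h0
  set y1 := peirceP1 e y with hy1
  set y0 := peirceP0 e y with hy0
  have hdec : y = c • e + y1 + y0 := by rw [← hc, peirce_decomposition]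
  have hcn : ‖c‖ ≤ 3 := by
    have := he.norm_peirceP2_apply_le y
    rw [hc, norm_smul, hen] at this
    linarith
  have hy1n : ‖y1‖ ≤ 8 := (he.norm_peirceP1_apply_le y).trans (by linarith)
  have hy0n : ‖y0‖ ≤ 6 := (he.norm_peirceP0_apply_le y).trans (by linarith)
  -- `e + t y` with its Peirce-1 part `t y1` removed
  set z := (1 + (t : ℂ) * c) • e + (t : ℂ) • y0 with hz
  have htn : ‖(t : ℂ)‖ = t := by rw [Complex.norm_real, Real.norm_of_nonneg ht0.le]
  have hz1 : ‖z‖ ≤ 1 + t * c.re + 23 * t ^ 2 := by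
    have h1 := he.norm_smul_add_sq_le (y := (t : ℂ) • y0)
      (by rw [map_smul, hy0, he.L_peirceP0, smul_zero]) (1 + (t : ℂ) * c)
    rw [← hz, norm_smul, htn] at h1
    have h2 : ‖1 + (t : ℂ) * c‖ ^ 2 = 1 + 2 * (t * c.re) + t ^ 2 * ‖c‖ ^ 2 := by
      rw [← Complex.normSq_eq_norm_sq, ← Complex.normSq_eq_norm_sq, Complex.normSq_apply,
        Complex.normSq_apply]
      simp
      ring
    have h3 : ‖c‖ ^ 2 ≤ 9 := by nlinarith [norm_nonneg c]
    have h4 : ‖y0‖ ^ 2 ≤ 36 := by nlinarith [norm_nonneg y0]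
    have h5 : ‖z‖ ^ 2 ≤ 1 + 2 * (t * c.re) + 45 * t ^ 2 := by nlinarith [sq_nonneg t]
    nlinarith [sq_nonneg (‖z‖ - 1), sq_nonneg t]
  have hz2 : ‖z‖ ≤ 10 := by
    have : c.re ≤ 3 := (Complex.re_le_norm c).trans hcn
    nlinarith
  set a := e + Complex.I • y1 with ha
  set b := e - Complex.I • y1 with hb
  have hIy : ‖Complex.I • y1‖ ≤ 8 := by rwa [norm_smul, Complex.norm_I, one_mul]
  have han : ‖a‖ ≤ 9 := (norm_add_le _ _).trans (by linarith)
  have hbn : ‖b‖ ≤ 9 := (norm_sub_le _ _).trans (by linarith)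
  have hLn : ∀ v : E, ‖v‖ ≤ 9 → ∀ x, ‖L v v x‖ ≤ 81 * ‖x‖ := by
    intro v hv x
    refine (L v v).le_of_opNorm_le ?_ x
    rw [norm_L_self]
    nlinarith [norm_nonneg v]
  have habe : L a a e - L b b e = Complex.I • y1 := by
    rw [← sub_apply, L_add_I_smul_sub, smul_apply, sub_apply, hy1, he.L_peirceP1_self, L_symm,
      he.L_peirceP1]
    module
  -- `1 - i t L(a, a)` and `1 + i t L(b, b)` are isometries up to second order, and their product
  -- sends `z` to `z + t y1 = e + t y` up to `t² r`
  set w := z + (Complex.I * (t : ℂ)) • L b b z with hw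
  set r := L a a (L b b z) + c • y1 - Complex.I • (L a a y0 - L b b y0) with hr
  have hmain : e + (t : ℂ) • y =
      (w + (Complex.I * ((-t : ℝ) : ℂ)) • L a a w) - ((t : ℂ) ^ 2) • r := by
    have habz : L a a z = L b b z + (1 + (t : ℂ) * c) • (Complex.I • y1) +
        (t : ℂ) • (L a a y0 - L b b y0) := by
      rw [← habe, hz]
      simp only [map_add, map_smul]
      module
    have hzy : e + (t : ℂ) • y = z + (t : ℂ) • y1 := by
      rw [hz, hdec]
      module
    have hI : ∀ v : E, (Complex.I * Complex.I) • v = -v := fun v => by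
      rw [Complex.I_mul_I, neg_one_smul]
    have hw' : L a a w = L a a z + (Complex.I * (t : ℂ)) • L a a (L b b z) := by
      rw [hw, map_add, map_smul]
    rw [hzy, hw', habz, hr, hw]
    push_cast
    linear_combination (norm := module) (t : ℂ) • (1 + (t : ℂ) * c) • hI y1 +
      ((t : ℂ) ^ 2) • hI (L a a (L b b z))
  have hrn : ‖r‖ ≤ 67000 := by
    have h1 := hLn a han (L b b z)
    have h2 := hLn b hbn z
    have h3 := hLn a han y0
    have h4 := hLn b hbn y0
    have h5 : ‖c • y1‖ ≤ 24 := by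
      rw [norm_smul]
      nlinarith [norm_nonneg c, norm_nonneg y1]
    have h6 : ‖Complex.I • (L a a y0 - L b b y0)‖ ≤ 972 := by
      rw [norm_smul, Complex.norm_I, one_mul]
      exact (norm_sub_le _ _).trans (by linarith)
    refine (norm_sub_le _ _).trans ((add_le_add_left (norm_add_le _ _) _).trans ?_)
    linarith
  have hw1 := norm_add_I_mul_smul_L_apply_le b 9 t hbn (by rw [abs_of_pos ht0]; linarith) z
  have hw2 := norm_add_I_mul_smul_L_apply_le a 9 (-t) han
    (by rw [abs_neg, abs_of_pos ht0]; linarith) w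
  rw [abs_neg] at hw2
  rw [abs_of_pos ht0] at hw1 hw2
  rw [← hw] at hw1
  set u := (t * 9 ^ 2) ^ 2 with hu
  have hu0 : 0 ≤ u := sq_nonneg _
  have hu1 : u ≤ 1 := by
    rw [hu]
    exact pow_le_one₀ (by positivity) (by linarith)
  have hwn : ‖w + (Complex.I * ((-t : ℝ) : ℂ)) • L a a w‖ ≤ ‖z‖ + 30 * u := by
    calc _ ≤ (1 + u) * ‖w‖ := hw2
      _ ≤ (1 + u) * ((1 + u) * ‖z‖) := by gcongr
      _ = ‖z‖ + (2 * u + u * u) * ‖z‖ := by ring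
      _ ≤ ‖z‖ + (2 * u + 1 * u) * 10 := by gcongr
      _ = ‖z‖ + 30 * u := by ring
  rw [hmain]
  refine (norm_sub_le _ _).trans ?_
  rw [norm_smul, norm_pow, htn]
  have hu' : u = 6561 * t ^ 2 := by rw [hu]; ring
  have h7 : t ^ 2 * ‖r‖ ≤ t ^ 2 * 67000 := by gcongr
  nlinarith [sq_nonneg t]

end JBStarTriple

open JBStarTriple in
theorem propositionp {E : Type*} [NormedAddCommGroup E] [NormedSpace ℂ E] [CompleteSpace E]
    [JBStarTriple E] (e : E) (he : JBStarTriple.IsMinimalTripotent e) :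
    ∀ ε : ℝ, 0 < ε → ∃ δ : ℝ, 0 < δ ∧
      ∀ x ∈ Metric.sphere (0 : E) 1, 2 - δ < ‖e - x‖ →
        2 - ε < ‖JBStarTriple.peirceP2 e (e - x)‖ := by
  intro ε hε
  obtain ⟨h0, htr, hmin⟩ := he
  have hen := htr.norm_eq_one h0
  -- the bound on `‖e - t x‖` is divided by `t` below, so its error `300000 t²` and the loss `δ`
  -- must each be at most `t ε / 2`
  obtain ⟨t, ht0, ht1, htε⟩ : ∃ t : ℝ, 0 < t ∧ t ≤ 1 / 81 ∧ 300000 * t ≤ ε / 2 :=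
    ⟨min (1 / 81) (ε / 600000), by positivity, min_le_left _ _, by
      linarith [min_le_right (1 / 81) (ε / 600000)]⟩
  refine ⟨t * (ε / 2), by positivity, fun x hx hδ => ?_⟩
  have hxn : ‖x‖ = 1 := by simpa using hx
  have hmem : peirceP2 e x ∈ peirceSpace 2 e := by
    rw [peirceSpace, Module.End.mem_eigenspace_iff]
    simpa using htr.L_peirceP2 x
  rw [hmin, Submodule.mem_span_singleton] at hmem
  obtain ⟨c, hc⟩ := hmem
  have hup := htr.norm_add_smul_le h0 (y := -x) (c := -c) (by rw [norm_neg, hxn])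
    (by rw [map_neg, ← hc, neg_smul]) ht0 ht1
  have hlow : ‖e - x‖ ≤ ‖e + (t : ℂ) • (-x)‖ + (1 - t) := by
    have h1 : e - x = (e + (t : ℂ) • (-x)) - ((1 - t : ℝ) : ℂ) • x := by
      push_cast
      module
    rw [h1]
    refine (norm_sub_le _ _).trans ?_
    rw [norm_smul, hxn, mul_one, Complex.norm_real, Real.norm_of_nonneg (by linarith)]
  have hre : 1 - ε < -c.re := by
    rw [Complex.neg_re] at hup
    have h2 : t * (300000 * t) ≤ t * (ε / 2) := by gcongr
    have h3 : t * (1 - ε) < t * (-c.re) := by nlinarith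
    exact lt_of_mul_lt_mul_left h3 ht0.le
  have hP : peirceP2 e (e - x) = (1 - c) • e := by
    have he' : L e e e = e := htr
    have : peirceP2 e e = e := by
      rw [peirceP2_apply, he', he']
      module
    rw [map_sub, this, ← hc, sub_smul, one_smul]
  rw [hP, norm_smul, hen, mul_one]
  have h4 := Complex.re_le_norm (1 - c)
  rw [Complex.sub_re, Complex.one_re] at h4
  linarith
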